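/- Let $G$ be a unimodular locally compact group with (regular) Haar measure $\mu$, and let $\lambda$ be its left regular representation on $L^2(G,\mu)$, $(\lambda_x\xi)(y)=\xi(x^{-1}y)$. Let $C^*_r(G)$ be the reduced group $C^*$-algebra, i.e. the norm-closed $*$-subalgebra of $\mathcal{B}(L^2(G,\mu))$ generated by the convolution operators $\lambda(f)\xi=\int_G f(x)\,\lambda_x\xi\,d\mu(x)$, $f\in C_c(G)$. Then $C^*_r(G)$ is quasi-directly finite: writing $a\bullet b=a+b-ab$, for every $a\in C^*_r(G)$, if there is $b\in C^*_r(G)$ with $b\bullet a=0$, then there is $c\in C^*_r(G)$ with $a\bullet c=0$. Equivalently, the (forced) unitization $C^*_r(G)\oplus\mathbb{C}$ is directly finite: $uv=1$ implies $vu=1$ for all $u,v$ in it. -/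

import Mathlib

open MeasureTheory
open scoped ENNReal CompactlySupported

/-- `b` is a right quasi-inverse of `a`, and `a` is a left quasi-inverse of `b`:
`a + b - a b = 0`. -/
def IsQuasiInversePair {R : Type*} [NonUnitalRing R] (a b : R) : Prop :=
  a + b - a * b = 0

/-- A ring, possibly without identity, is quasi-directly finite if every element that has a left
quasi-inverse also has a right quasi-inverse. -/
def IsQuasiDirectlyFinite (R : Type*) [NonUnitalRing R] : Prop :=
  ∀ a : R, (∃ b : R, IsQuasiInversePair b a) → ∃ c : R, IsQuasiInversePair a c

noncomputable section

namespace GroupCStar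

variable {G : Type*} [Group G] [TopologicalSpace G] [IsTopologicalGroup G]
  [MeasurableSpace G] [BorelSpace G]

/-- The left regular representation on `L²(G, μ)`: `(λ_x ξ)(y) = ξ (x⁻¹ y)`. -/
def leftRegular (μ : Measure G) [μ.IsHaarMeasure] (x : G) : Lp ℂ 2 μ →ₗᵢ[ℂ] Lp ℂ 2 μ :=
  Lp.compMeasurePreservingₗᵢ ℂ (fun y => x⁻¹ * y) (measurePreserving_mul_left μ x⁻¹)

variable [LocallyCompactSpace G] (μ : Measure G) [μ.IsHaarMeasure] [μ.Regular]

/-- The left regular representation is strongly continuous. -/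
theorem continuous_leftRegular (ξ : Lp ℂ 2 μ) : Continuous fun x : G => leftRegular μ x ξ := by
  let g : C(G, C(G, G)) :=
    (ContinuousMap.mk (fun a : G × G => a.1⁻¹ * a.2) (by fun_prop)).curry
  exact (continuous_const (y := ξ)).compMeasurePreservingLp g.continuous
    (fun x => measurePreserving_mul_left μ x⁻¹) ENNReal.ofNat_ne_top

theorem integrable_smul_leftRegular (f : C_c(G, ℂ)) (ξ : Lp ℂ 2 μ) :
    Integrable (fun x : G => f x • leftRegular μ x ξ) μ :=
  (f.continuous.smul (continuous_leftRegular μ ξ)).integrable_of_hasCompactSupport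
    f.hasCompactSupport.smul_right

/-- The integrated form of the left regular representation: for `f ∈ C_c(G)` this is the bounded
operator `λ(f) ξ = ∫ f(x) λ_x ξ dμ(x)` on `L²(G, μ)`, that is, `ξ ↦ f * ξ`. -/
def convOperator (f : C_c(G, ℂ)) : Lp ℂ 2 μ →L[ℂ] Lp ℂ 2 μ :=
  LinearMap.mkContinuous
    { toFun := fun ξ => ∫ x, f x • leftRegular μ x ξ ∂μ
      map_add' := fun ξ η => by
        simp only [map_add, smul_add]
        exact integral_add (integrable_smul_leftRegular μ f ξ) (integrable_smul_leftRegular μ f η)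
      map_smul' := fun c ξ => by
        simp only [map_smul, RingHom.id_apply]
        rw [← integral_smul]
        simp only [smul_comm c] }
    (∫ x, ‖f x‖ ∂μ)
    (fun ξ => by
      refine (norm_integral_le_integral_norm _).trans_eq ?_
      simp only [norm_smul, LinearIsometry.norm_map]
      exact integral_mul_const _ _)

/-- The reduced group C⋆-algebra `C*_r(G)`: the norm-closed ⋆-subalgebra of the bounded operators
on `L²(G, μ)` generated by the operators `λ(f)`, `f ∈ C_c(G)`. No identity is adjoined. -/
def reducedCStar : NonUnitalStarSubalgebra ℂ (Lp ℂ 2 μ →L[ℂ] Lp ℂ 2 μ) :=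
  (NonUnitalStarAlgebra.adjoin ℂ (Set.range (convOperator μ))).topologicalClosure

end GroupCStar

end

/-! Kaplansky's trace argument, with the trace replaced by limits of vector functionals. Let M be
the commutant of the right translations (`rightCommutant`) and I the left ideal of those T in M that
act on `C_c(G)` as h ↦ ξ * h for some ξ in L² (`leftBoundedIdeal`). I is self-adjoint and contains
every λ(f), so C*_r(G) lies in its norm closure. Along an L¹-normalized approximate unit φ, ⟨φ, STφ⟩
→ ⟨Jξ, η⟩ when S, T in I have symbols ξ, η. This limit is symmetric in S and T because J is an
antiunitary involution, and Tφ → ξ, which determines T. Both facts rest on unimodularity.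
`mul_eq_one_of_asymptotic_trace` does the algebra. If u(1 - a) = 1, approximate a by a' in I; 1 - a'
still has a left inverse u'. The defect 1 - (1 - a')u' is an idempotent and a commutator of elements
of I, so it has trace zero. So has its range projection, which therefore vanishes. The conclusion
then passes back from a' to a. -/

open Filter Topology

/-! ### Range projections of idempotents -/

section RangeProjection

variable {H : Type*} [NormedAddCommGroup H] [InnerProductSpace ℂ H] [CompleteSpace H]

/-- The orthogonal projection onto the range of an idempotent operator lies in the von Neumann
algebra generated by the idempotent. -/
theorem exists_isStarProjection_of_isIdempotentElem {e : H →L[ℂ] H} (he : IsIdempotentElem e) :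
    ∃ q : H →L[ℂ] H, IsStarProjection q ∧ q * e = e ∧ e * q = q ∧
      ∀ U : H →L[ℂ] H, Commute U e → Commute (star U) e → Commute U q := by
  let K : Submodule ℂ H := (LinearMap.ker (1 - e : H →L[ℂ] H).toLinearMap)
  have hK : ∀ x, x ∈ K ↔ e x = x := fun x => by
    simp [K, sub_eq_zero, eq_comm (a := e x)]
  have hKc : IsClosed (K : Set H) := (1 - e : H →L[ℂ] H).isClosed_ker
  have : CompleteSpace K := hKc.completeSpace_coe
  have hee : ∀ x, e (e x) = e x := fun x => congrArg (fun T : H →L[ℂ] H => T x) he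
  refine ⟨K.starProjection, isStarProjection_starProjection, ?_, ?_, ?_⟩
  · ext x
    exact K.starProjection_eq_self_iff.2 ((hK _).2 (hee x))
  · ext x
    exact (hK _).1 (K.starProjection_apply_mem x)
  · intro U hU hU'
    -- Both U and its adjoint preserve the range K of e, so K reduces U.
    have hcomm : ∀ {V : H →L[ℂ] H}, Commute V e → ∀ k ∈ K, V k ∈ K := fun {V} hV k hk => by
      rw [hK] at hk ⊢
      have := congrArg (fun T : H →L[ℂ] H => T k) hV.eq
      simp only [mul_apply_eq_comp, hk] at this
      exact this.symm
    ext x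
    refine (K.eq_starProjection_of_mem_of_inner_eq_zero
      (hcomm hU _ (K.starProjection_apply_mem x)) fun w hw => ?_).symm
    change inner ℂ (U x - U (K.starProjection x)) w = 0
    rw [← map_sub, ← ContinuousLinearMap.adjoint_inner_right]
    exact K.starProjection_inner_eq_zero x _ (hcomm hU' w hw)

end RangeProjection

/-! ### The abstract trace argument -/

section AsymptoticTrace

variable {H : Type*} [NormedAddCommGroup H] [InnerProductSpace ℂ H] [CompleteSpace H]

/-- Let `M` be a commutant, and let `I` be a self-adjoint left ideal of `M` on which the vector
functionals along a filter are asymptotically a faithful trace. Then left inverses of `1 - a`, for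
`a` in the closure of `I`, are right inverses. -/
theorem mul_eq_one_of_asymptotic_trace (s : Set (H →L[ℂ] H)) (I : Submodule ℂ (H →L[ℂ] H))
    (l : Filter H)
    (hIM : ∀ T ∈ I, T ∈ StarSubalgebra.centralizer ℂ s)
    (hstar : ∀ T ∈ I, star T ∈ I)
    (hmul : ∀ S ∈ StarSubalgebra.centralizer ℂ s, ∀ T ∈ I, S * T ∈ I)
    (htrace : ∀ S ∈ I, ∀ T ∈ I, Tendsto (fun φ => inner ℂ φ ((S * T - T * S) φ)) l (𝓝 0))
    (hfaithful : ∀ T ∈ I, Tendsto (fun φ => T φ) l (𝓝 0) → T = 0)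
    {a u : H →L[ℂ] H} (ha : a ∈ closure (I : Set (H →L[ℂ] H)))
    (hu : u ∈ StarSubalgebra.centralizer ℂ s) (hua : u * (1 - a) = 1) :
    (1 - a) * u = 1 := by
  set M := StarSubalgebra.centralizer ℂ s
  obtain ⟨a', ha', hdist⟩ : ∃ a' ∈ I, ‖u * (a' - a)‖ < 1 := by
    have hc : Continuous fun x : H →L[ℂ] H => ‖u * (x - a)‖ := by fun_prop
    have h0 : ∀ᶠ x in 𝓝 a, ‖u * (x - a)‖ < 1 :=
      hc.continuousAt.eventually_lt continuousAt_const (by simp)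
    obtain ⟨x, hx, hxI⟩ := mem_closure_iff_frequently.1 ha |>.and_eventually h0 |>.exists
    exact ⟨x, hx, hxI⟩
  have ha'M := hIM a' ha'
  -- Since u(1 - a) = 1, this unit equals u(1 - a'); its inverse stays in the commutant and corrects
  -- u to a left inverse of 1 - a'.
  let X : (H →L[ℂ] H)ˣ := Units.oneSub (u * (a' - a)) hdist
  have hX : (X : H →L[ℂ] H) = u * (1 - a') := by
    simp only [X, Units.val_oneSub]
    nth_rewrite 1 [← hua]; noncomm_ring
  have hXM : (X : H →L[ℂ] H) ∈ M := hX ▸ mul_mem hu (sub_mem (one_mem M) ha'M)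
  have hwM : (↑X⁻¹ : H →L[ℂ] H) ∈ M := by
    have : (X : H →L[ℂ] H) ∈ Set.centralizer (s ∪ star s) := hXM
    exact fun m hm => (Commute.units_inv_right (u := X) (this m hm)).eq
  set u' : H →L[ℂ] H := ↑X⁻¹ * u with hu'
  have hu'M : u' ∈ M := mul_mem hwM hu
  have hua' : u' * (1 - a') = 1 := by
    rw [hu', mul_assoc, ← hX, X.inv_mul]
  set b' : H →L[ℂ] H := 1 - u' with hb'
  have hb'I : b' ∈ I := by
    have : b' = -(u' * a') := by
      rw [hb', ← hua']; noncomm_ring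
    rw [this]
    exact I.neg_mem (hmul _ hu'M _ ha')
  have hb'M := hIM b' hb'I
  set e : H →L[ℂ] H := 1 - (1 - a') * u' with he
  have hecomm : e = b' * a' - a' * b' := by
    have : b' * a' - a' * b' = u' * (1 - a') - (1 - a') * u' := by rw [hb']; noncomm_ring
    rw [this, hua', he]
  have heI : e ∈ I := hecomm ▸ I.sub_mem (hmul _ hb'M _ ha') (hmul _ ha'M _ hb'I)
  have hidem : IsIdempotentElem e := by
    refine IsIdempotentElem.one_sub ?_
    change (1 - a') * u' * ((1 - a') * u') = _
    rw [mul_assoc, ← mul_assoc u', hua', one_mul]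
  have heM := hIM e heI
  obtain ⟨q, hq, hqe, heq, hqcomm⟩ := exists_isStarProjection_of_isIdempotentElem hidem
  have hqM : q ∈ M := by
    rw [StarSubalgebra.mem_centralizer_iff] at heM ⊢
    exact fun g hg => ⟨(hqcomm g (heM g hg).1 (heM g hg).2).eq,
      (hqcomm (star g) (heM g hg).2 (by rw [star_star]; exact (heM g hg).1)).eq⟩
  -- Taking adjoints in eq = q gives q = q e*, a member of the left ideal since I is self-adjoint.
  have hqI : q ∈ I := by
    have : q = q * star e := by
      have := congrArg star heq
      rw [star_mul, hq.isSelfAdjoint.star_eq] at this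
      exact this.symm
    rw [this]
    exact hmul _ hqM _ (hstar _ heI)
  have hq0 : q = 0 := by
    refine hfaithful q hqI ?_
    -- The commutators [b', a'] = e and [q, e] = e - q both have trace zero, so q has too; and ⟨φ,
    -- qφ⟩ = ‖qφ‖².
    have h1 := htrace _ hb'I _ ha'
    have h2 := htrace _ hqI _ heI
    rw [← hecomm] at h1
    rw [hqe, heq] at h2
    have h3 := h1.sub h2
    simp only [← inner_sub_right, ← sub_apply, sub_sub_cancel, sub_zero] at h3
    have h4 : ∀ φ, inner ℂ φ (q φ) = ((‖q φ‖ ^ 2 : ℝ) : ℂ) := fun φ => by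
      have hqq : q φ = q (q φ) := congrArg (fun T : H →L[ℂ] H => T φ) hq.isIdempotentElem.symm
      conv_lhs => rw [hqq]
      rw [← ContinuousLinearMap.adjoint_inner_left, ← ContinuousLinearMap.star_eq_adjoint,
        hq.isSelfAdjoint.star_eq, inner_self_eq_norm_sq_to_K]
      norm_cast
    simp only [h4] at h3
    have h5 : Tendsto (fun φ => ‖q φ‖ ^ 2) l (𝓝 0) := by
      exact_mod_cast (Complex.continuous_re.tendsto _).comp h3
    rw [tendsto_zero_iff_norm_tendsto_zero]
    simpa using h5.sqrt
  have he0 : e = 0 := by rw [← hqe, hq0, zero_mul]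
  have h1 : (1 - a') * u' = 1 := (sub_eq_zero.1 he0).symm
  have h2 : 1 - a = (1 - a') * ↑X⁻¹ := by
    calc 1 - a = (1 - a') * u' * (1 - a) := by rw [h1, one_mul]
      _ = (1 - a') * ↑X⁻¹ * (u * (1 - a)) := by rw [hu']; noncomm_ring
      _ = _ := by rw [hua, mul_one]
  rw [h2, mul_assoc]
  exact h1

end AsymptoticTrace

/-! ### Density of compactly supported continuous functions in L² -/

section Density

variable {X E : Type*} [TopologicalSpace X] [MeasurableSpace X] [BorelSpace X]
  [NormedAddCommGroup E] [NormedSpace ℝ E]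

theorem CompactlySupportedContinuousMap.memLp {p : ℝ≥0∞} {μ : Measure X}
    [IsFiniteMeasureOnCompacts μ] (f : C_c(X, ℂ)) : MemLp f p μ :=
  f.continuous.memLp_of_hasCompactSupport f.hasCompactSupport

/-- The class in `L²` of a compactly supported continuous function. -/
noncomputable def CompactlySupportedContinuousMap.toL2 (μ : Measure X)
    [IsFiniteMeasureOnCompacts μ] (f : C_c(X, ℂ)) : Lp ℂ 2 μ :=
  f.memLp.toLp f

variable [R1Space X] [LocallyCompactSpace X]

/-- In a locally compact space that need not be normal, functions in `ℒp` are approximated by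
compactly supported continuous functions when `p < ∞`. -/
theorem MeasureTheory.MemLp.exists_compactlySupported_eLpNorm_sub_le {μ : Measure X} [μ.Regular]
    {p : ℝ≥0∞} (hp : p ≠ ∞) {f : X → E} (hf : MemLp f p μ) {ε : ℝ≥0∞} (hε : ε ≠ 0) :
    ∃ g : X → E, eLpNorm (f - g) p μ ≤ ε ∧ Continuous g ∧ HasCompactSupport g := by
  refine hf.induction_dense hp (fun g => Continuous g ∧ HasCompactSupport g) ?_ ?_ ?_ hε
  · intro c t ht htμ ε hε
    obtain ⟨η, ηpos, hη⟩ := exists_eLpNorm_indicator_le (μ := μ) hp c hε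
    have hη2 : (η / 2 : ℝ≥0∞) ≠ 0 := by simpa using ηpos.ne'
    obtain ⟨V, tV, V_open, -, hV⟩ := ht.exists_isOpen_sdiff_lt htμ.ne hη2
    obtain ⟨K, Kt, K_compact, -, hK⟩ := ht.exists_isCompact_isClosed_sdiff_lt htμ.ne hη2
    obtain ⟨g, hg1, hgc, hgV, hg01⟩ :=
      exists_continuousMap_one_of_isCompact_subset_isOpen K_compact V_open (Kt.trans tV)
    refine ⟨fun x => g x • c, ?_, by fun_prop, HasCompactSupport.smul_right hgc⟩
    have hVK : μ (V \ K) ≤ η := by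
      calc μ (V \ K) ≤ μ (V \ t ∪ t \ K) := measure_mono fun x hx => by
            by_cases hxt : x ∈ t
            · exact Or.inr ⟨hxt, hx.2⟩
            · exact Or.inl ⟨hx.1, hxt⟩
        _ ≤ μ (V \ t) + μ (t \ K) := measure_union_le _ _
        _ ≤ η / 2 + η / 2 := add_le_add hV.le hK.le
        _ = η := ENNReal.add_halves _
    -- With K ⊆ t ⊆ V, the bump g and the indicator of t agree off V \ K and differ by at most 1 on
    -- it.
    refine (eLpNorm_mono fun x => ?_).trans (hη _ hVK)
    by_cases hxK : x ∈ K
    · simp [hg1 hxK, Kt hxK]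
    by_cases hxV : x ∈ V
    · rw [Set.indicator_of_mem (show x ∈ V \ K from ⟨hxV, hxK⟩)]
      by_cases hxt : x ∈ t
      · have : g x • c - c = -((1 - g x) • c) := by rw [sub_smul, one_smul]; abel
        simp only [Pi.sub_apply, Set.indicator_of_mem hxt]
        rw [this, norm_neg, norm_smul, Real.norm_of_nonneg (sub_nonneg.2 (hg01 x).2)]
        exact mul_le_of_le_one_left (norm_nonneg _) (by linarith [(hg01 x).1])
      · simp only [Pi.sub_apply, Set.indicator_of_notMem hxt, sub_zero]
        rw [norm_smul, Real.norm_of_nonneg (hg01 x).1]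
        exact mul_le_of_le_one_left (norm_nonneg _) (hg01 x).2
    · have : g x = 0 := image_eq_zero_of_notMem_tsupport fun h => hxV (hgV h)
      simp [this, show x ∉ t from fun h => hxV (tV h)]
  · exact fun f g hf hg => ⟨hf.1.add hg.1, hf.2.add hg.2⟩
  · exact fun f hf => (hf.1.memLp_of_hasCompactSupport (p := p) hf.2).aestronglyMeasurable

theorem CompactlySupportedContinuousMap.denseRange_toL2 (μ : Measure X) [μ.Regular] :
    DenseRange (CompactlySupportedContinuousMap.toL2 μ) := by
  refine fun ξ => EMetric.mem_closure_iff.2 fun ε hε => ?_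
  obtain ⟨δ, hδ, hδε⟩ := exists_between hε
  obtain ⟨g, hg, hgc, hgs⟩ :=
    (Lp.memLp ξ).exists_compactlySupported_eLpNorm_sub_le ENNReal.ofNat_ne_top hδ.ne'
  refine ⟨_, ⟨⟨⟨g, hgc⟩, hgs⟩, rfl⟩, lt_of_le_of_lt ?_ hδε⟩
  rw [Lp.edist_def]
  refine (eLpNorm_congr_ae ?_).trans_le hg
  exact (Filter.EventuallyEq.refl _ _).sub (MemLp.coeFn_toLp _)

end Density

theorem MeasureTheory.inner_toLp {X : Type*} [MeasurableSpace X] {μ : Measure X} {f g : X → ℂ}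
    (hf : MemLp f 2 μ) (hg : MemLp g 2 μ) :
    inner ℂ (hf.toLp f) (hg.toLp g) = ∫ x, starRingEnd ℂ (f x) * g x ∂μ := by
  rw [L2.inner_def]
  refine integral_congr_ae ?_
  filter_upwards [hf.coeFn_toLp, hg.coeFn_toLp] with x hx hy
  rw [hx, hy, RCLike.inner_apply']

/-- A regular Haar measure that is right invariant is invariant under inversion. -/
theorem MeasureTheory.Measure.IsHaarMeasure.isInvInvariant_of_isMulRightInvariant
    {G : Type*} [Group G] [TopologicalSpace G] [IsTopologicalGroup G] [LocallyCompactSpace G]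
    [MeasurableSpace G] [BorelSpace G] (μ : Measure G) [μ.IsHaarMeasure] [μ.Regular]
    [μ.IsMulRightInvariant] : μ.IsInvInvariant := by
  constructor
  let c : ℝ≥0∞ := μ.inv.haarScalarFactor μ
  have hc : μ.inv = c • μ := Measure.isMulLeftInvariant_eq_smul_of_regular μ.inv μ
  -- Inverting twice scales μ by c²; evaluating on a compact set of positive measure forces c = 1.
  have hcc : μ = c ^ 2 • μ := by
    conv_lhs => rw [← Measure.inv_inv μ]
    rw [hc, Measure.inv, Measure.map_smul, ← Measure.inv, hc, smul_smul, pow_two]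
  let K : TopologicalSpace.PositiveCompacts G := Classical.arbitrary _
  have h1 : c ^ 2 * μ K = 1 ^ 2 * μ K := by
    conv_rhs => rw [hcc]
    simp
  have h2 : c ^ 2 = 1 ^ 2 :=
    (ENNReal.mul_left_inj (measure_pos_of_nonempty_interior _ K.interior_nonempty).ne'
      K.isCompact.measure_lt_top.ne).1 h1
  rw [hc, (ENNReal.pow_right_strictMono two_ne_zero).injective h2, one_smul]

/-! ### Convolution, the conjugation J and approximate units -/

noncomputable section

namespace GroupCStar

/-- Supplies the hypothesis of the Fubini theorem for compactly supported continuous integrands,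
which needs no σ-finiteness of μ. -/
theorem hasCompactSupport_uncurry_of_mul {X Y : Type*} [TopologicalSpace X] [R1Space X]
    [TopologicalSpace Y] [R1Space Y] (k : C_c(Y, ℂ)) (h : C_c(X, ℂ)) (F : X → Y → ℂ)
    (hF : ∀ y z, k z = 0 ∨ h y = 0 → F y z = 0) :
    HasCompactSupport (Function.uncurry F) := by
  refine HasCompactSupport.intro (h.hasCompactSupport.prod k.hasCompactSupport) ?_
  rintro ⟨y, z⟩ hyz
  rw [Set.mem_prod, not_and_or] at hyz
  exact hF y z (hyz.symm.imp image_eq_zero_of_notMem_tsupport image_eq_zero_of_notMem_tsupport)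

/-- The filter of approximate units in `C_c(G)`: functions of integral one and `L¹` norm at most
one, whose supports shrink to the identity. -/
def approxUnit {G : Type*} [One G] [TopologicalSpace G] [MeasurableSpace G] (μ : Measure G) : Filter C_c(G, ℂ) :=
  (𝓝 (1 : G)).lift' fun U =>
    {φ | ∫ y, φ y ∂μ = 1 ∧ ∫ y, ‖φ y‖ ∂μ ≤ 1 ∧ Function.support φ ⊆ U}

theorem monotone_approxUnit_sets {G : Type*} [TopologicalSpace G] [MeasurableSpace G]
    (μ : Measure G) : Monotone fun U : Set G =>
    {φ : C_c(G, ℂ) | ∫ y, φ y ∂μ = 1 ∧ ∫ y, ‖φ y‖ ∂μ ≤ 1 ∧ Function.support φ ⊆ U} :=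
  fun _ _ hUV _ hφ => ⟨hφ.1, hφ.2.1, hφ.2.2.trans hUV⟩

variable {G : Type*} [Group G] [TopologicalSpace G] [IsTopologicalGroup G]
  [MeasurableSpace G] [BorelSpace G]

/-- Right translation on `L²(G, μ)`: `(ρ_y ξ)(x) = ξ (x y⁻¹)`. -/
def rightTranslation (μ : Measure G) [μ.IsMulRightInvariant] (y : G) :
    Lp ℂ 2 μ →ₗᵢ[ℂ] Lp ℂ 2 μ :=
  Lp.compMeasurePreservingₗᵢ ℂ (fun x => x * y⁻¹) (measurePreserving_mul_right μ y⁻¹)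

/-- The conjugation `(J ξ)(x) = conj (ξ (x⁻¹))` on `L²(G, μ)`, as a real-linear map. -/
def modularConj (μ : Measure G) [μ.IsInvInvariant] : Lp ℂ 2 μ →L[ℝ] Lp ℂ 2 μ :=
  (Complex.conjCLE.toContinuousLinearMap.compLpL 2 μ) ∘L
    (Lp.compMeasurePreservingₗᵢ ℝ Inv.inv (Measure.measurePreserving_inv μ)).toContinuousLinearMap

theorem modularConj_ae (μ : Measure G) [μ.IsInvInvariant] (ξ : Lp ℂ 2 μ) :
    modularConj μ ξ =ᵐ[μ] fun x => starRingEnd ℂ (ξ x⁻¹) := by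
  refine (ContinuousLinearMap.coeFn_compLpL _ _).trans ?_
  filter_upwards [Lp.coeFn_compMeasurePreserving ξ (Measure.measurePreserving_inv μ)] with x hx
  exact congrArg (starRingEnd ℂ) hx

theorem inner_modularConj (μ : Measure G) [μ.IsInvInvariant] (ξ η : Lp ℂ 2 μ) :
    inner ℂ (modularConj μ ξ) (modularConj μ η) = inner ℂ η ξ := by
  rw [L2.inner_def, L2.inner_def, ← integral_inv_eq_self (fun x => inner ℂ (η x) (ξ x)) μ]
  refine integral_congr_ae ?_
  filter_upwards [modularConj_ae μ ξ, modularConj_ae μ η] with x hx hy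
  rw [hx, hy, RCLike.inner_apply, RCLike.inner_apply, RCLike.conj_conj, mul_comm]

theorem modularConj_modularConj (μ : Measure G) [μ.IsInvInvariant] (ξ : Lp ℂ 2 μ) :
    modularConj μ (modularConj μ ξ) = ξ := by
  refine Lp.ext ?_
  filter_upwards [modularConj_ae μ (modularConj μ ξ),
    (Measure.measurePreserving_inv μ).quasiMeasurePreserving.ae_eq_comp (modularConj_ae μ ξ)]
    with x hx hy
  rw [hx, show modularConj μ ξ x⁻¹ = starRingEnd ℂ (ξ x⁻¹⁻¹) from hy, inv_inv, RCLike.conj_conj]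

theorem rightTranslation_one (μ : Measure G) [μ.IsMulRightInvariant] (ξ : Lp ℂ 2 μ) :
    rightTranslation μ 1 ξ = ξ := by
  refine Lp.ext ?_
  filter_upwards [Lp.coeFn_compMeasurePreserving ξ (measurePreserving_mul_right μ (1 : G)⁻¹)]
    with x hx
  refine hx.trans ?_
  simp

theorem rightTranslation_inv (μ : Measure G) [μ.IsMulRightInvariant] (y : G) (ξ : Lp ℂ 2 μ) :
    rightTranslation μ y (rightTranslation μ y⁻¹ ξ) = ξ := by
  change Lp.compMeasurePreserving _ (measurePreserving_mul_right μ y⁻¹)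
      (Lp.compMeasurePreserving _ (measurePreserving_mul_right μ y⁻¹⁻¹) ξ) = ξ
  rw [← Lp.compMeasurePreserving_comp_apply]
  simp only [Function.comp_def, inv_mul_cancel_right, inv_inv]
  exact Lp.compMeasurePreserving_id_apply ξ

theorem leftRegular_rightTranslation (μ : Measure G) [μ.IsHaarMeasure]
    [μ.IsMulRightInvariant] (x y : G) (ξ : Lp ℂ 2 μ) :
    leftRegular μ x (rightTranslation μ y ξ) = rightTranslation μ y (leftRegular μ x ξ) := by
  change Lp.compMeasurePreserving _ (measurePreserving_mul_left μ x⁻¹)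
      (Lp.compMeasurePreserving _ (measurePreserving_mul_right μ y⁻¹) ξ) =
    Lp.compMeasurePreserving _ (measurePreserving_mul_right μ y⁻¹)
      (Lp.compMeasurePreserving _ (measurePreserving_mul_left μ x⁻¹) ξ)
  rw [← Lp.compMeasurePreserving_comp_apply, ← Lp.compMeasurePreserving_comp_apply]
  congr 1
  simp only [Function.comp_def, mul_assoc]

/-- The involution `f*(x) = conj (f (x⁻¹))` on `C_c(G)`. -/
def conjInv {G : Type*} [Group G] [TopologicalSpace G] [IsTopologicalGroup G]
    (f : C_c(G, ℂ)) : C_c(G, ℂ) :=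
  ⟨⟨fun x => starRingEnd ℂ (f x⁻¹), by fun_prop⟩,
    (f.hasCompactSupport.comp_homeomorph (Homeomorph.inv G)).comp_left (map_zero (starRingEnd ℂ))⟩

theorem conjInv_apply {G : Type*} [Group G] [TopologicalSpace G] [IsTopologicalGroup G]
    (f : C_c(G, ℂ)) (x : G) : conjInv f x = starRingEnd ℂ (f x⁻¹) := rfl

theorem modularConj_toL2 (μ : Measure G) [IsFiniteMeasureOnCompacts μ] [μ.IsInvInvariant] (f : C_c(G, ℂ)) :
    modularConj μ (f.toL2 μ) = (conjInv f).toL2 μ := by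
  refine Lp.ext ?_
  refine (modularConj_ae μ _).trans (EventuallyEq.trans ?_ (MemLp.coeFn_toLp _).symm)
  have h := MemLp.coeFn_toLp (f.memLp (p := 2) (μ := μ))
  filter_upwards [(Measure.measurePreserving_inv μ).quasiMeasurePreserving.ae_eq_comp h] with x hx
  exact congrArg (starRingEnd ℂ) hx

variable [LocallyCompactSpace G] (μ : Measure G) [μ.IsHaarMeasure] [μ.Regular]

theorem continuous_rightTranslation [μ.IsMulRightInvariant] (ξ : Lp ℂ 2 μ) :
    Continuous fun y : G => rightTranslation μ y ξ := by
  let g : C(G, C(G, G)) :=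
    (ContinuousMap.mk (fun a : G × G => a.2 * a.1⁻¹) (by fun_prop)).curry
  exact (continuous_const (y := ξ)).compMeasurePreservingLp g.continuous
    (fun y => measurePreserving_mul_right μ y⁻¹) ENNReal.ofNat_ne_top

theorem integrable_smul_rightTranslation [μ.IsMulRightInvariant] (h : C_c(G, ℂ)) (ξ : Lp ℂ 2 μ) :
    Integrable (fun y : G => h y • rightTranslation μ y ξ) μ :=
  (h.continuous.smul (continuous_rightTranslation μ ξ)).integrable_of_hasCompactSupport
    h.hasCompactSupport.smul_right

/-- Right convolution `ξ ↦ ξ * h = ∫ h(y) ρ_y ξ dμ(y)` by a function `h ∈ C_c(G)`. -/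
def rightConv [μ.IsMulRightInvariant] (h : C_c(G, ℂ)) : Lp ℂ 2 μ →L[ℂ] Lp ℂ 2 μ :=
  LinearMap.mkContinuous
    { toFun := fun ξ => ∫ y, h y • rightTranslation μ y ξ ∂μ
      map_add' := fun ξ η => by
        simp only [map_add, smul_add]
        exact integral_add (integrable_smul_rightTranslation μ h ξ)
          (integrable_smul_rightTranslation μ h η)
      map_smul' := fun c ξ => by
        simp only [map_smul, RingHom.id_apply]
        rw [← integral_smul]
        simp only [smul_comm c] }
    (∫ y, ‖h y‖ ∂μ)
    (fun ξ => by
      refine (norm_integral_le_integral_norm _).trans_eq ?_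
      simp only [norm_smul, LinearIsometry.norm_map]
      exact integral_mul_const _ _)

theorem rightConv_apply [μ.IsMulRightInvariant] (h : C_c(G, ℂ)) (ξ : Lp ℂ 2 μ) :
    rightConv μ h ξ = ∫ y, h y • rightTranslation μ y ξ ∂μ := rfl

theorem convOperator_apply (f : C_c(G, ℂ)) (ξ : Lp ℂ 2 μ) :
    convOperator μ f ξ = ∫ x, f x • leftRegular μ x ξ ∂μ := rfl

theorem inner_toL2_rightConv_toL2 [μ.IsMulRightInvariant] (k h f : C_c(G, ℂ)) :
    inner ℂ (k.toL2 μ) (rightConv μ h (f.toL2 μ)) =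
      ∫ y, ∫ z, starRingEnd ℂ (k z) * (h y * f (z * y⁻¹)) ∂μ ∂μ := by
  rw [rightConv_apply, ← integral_inner (integrable_smul_rightTranslation μ h _)]
  congr 1 with y
  rw [inner_smul_right]
  have : inner ℂ (k.toL2 μ) (rightTranslation μ y (f.toL2 μ)) =
      ∫ z, starRingEnd ℂ (k z) * f (z * y⁻¹) ∂μ :=
    inner_toLp k.memLp (f.memLp.comp_measurePreserving (measurePreserving_mul_right μ y⁻¹))
  rw [this, ← integral_const_mul]
  congr 1 with z
  ring

theorem inner_toL2_convOperator_toL2 (k f h : C_c(G, ℂ)) :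
    inner ℂ (k.toL2 μ) (convOperator μ f (h.toL2 μ)) =
      ∫ x, ∫ z, starRingEnd ℂ (k z) * (f x * h (x⁻¹ * z)) ∂μ ∂μ := by
  rw [convOperator_apply, ← integral_inner (integrable_smul_leftRegular μ f _)]
  congr 1 with x
  rw [inner_smul_right]
  have : inner ℂ (k.toL2 μ) (leftRegular μ x (h.toL2 μ)) =
      ∫ z, starRingEnd ℂ (k z) * h (x⁻¹ * z) ∂μ :=
    inner_toLp k.memLp (h.memLp.comp_measurePreserving (measurePreserving_mul_left μ x⁻¹))
  rw [this, ← integral_const_mul]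
  congr 1 with z
  ring

/-- Left convolution by `f` on `h` agrees with right convolution by `h` on `f`. -/
theorem convOperator_toL2 [μ.IsMulRightInvariant] (f h : C_c(G, ℂ)) :
    convOperator μ f (h.toL2 μ) = rightConv μ h (f.toL2 μ) := by
  have := Measure.IsHaarMeasure.isInvInvariant_of_isMulRightInvariant μ
  refine (CompactlySupportedContinuousMap.denseRange_toL2 μ).eq_of_inner_right ℂ fun k => ?_
  rw [inner_toL2_convOperator_toL2, inner_toL2_rightConv_toL2,
    integral_integral_swap_of_hasCompactSupport (μ := μ) (ν := μ)
      (f := fun x z => starRingEnd ℂ (k z) * (f x * h (x⁻¹ * z))),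
    integral_integral_swap_of_hasCompactSupport (μ := μ) (ν := μ)
      (f := fun y z => starRingEnd ℂ (k z) * (h y * f (z * y⁻¹)))]
  -- The substitution x = z y⁻¹ in the inner integral uses invariance under inversion.
  · congr 1 with z
    rw [integral_const_mul, integral_const_mul,
      ← integral_div_left_eq_self (fun x => f x * h (x⁻¹ * z)) μ z]
    congr 2 with y
    simp [div_eq_mul_inv, mul_comm]
  · simp only [Function.uncurry_def]; fun_prop
  · exact hasCompactSupport_uncurry_of_mul k h _ fun y z => by rintro (h0 | h0) <;> simp [h0]
  · simp only [Function.uncurry_def]; fun_prop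
  · exact hasCompactSupport_uncurry_of_mul k f _ fun y z => by rintro (h0 | h0) <;> simp [h0]

/-- This says that the adjoint of left convolution by ξ is left convolution by Jξ. For ξ in `C_c(G)`
it is Fubini, and both sides are continuous in ξ. -/
theorem inner_rightConv_toL2 [μ.IsMulRightInvariant] [μ.IsInvInvariant] (k h : C_c(G, ℂ))
    (ξ : Lp ℂ 2 μ) :
    inner ℂ (rightConv μ k ξ) (h.toL2 μ) =
      inner ℂ (k.toL2 μ) (rightConv μ h (modularConj μ ξ)) := by
  have hcont := (modularConj μ).continuous
  refine (CompactlySupportedContinuousMap.denseRange_toL2 μ).induction_on ξ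
    (isClosed_eq (by fun_prop) (by fun_prop)) fun f => ?_
  rw [modularConj_toL2, ← inner_conj_symm, inner_toL2_rightConv_toL2, inner_toL2_rightConv_toL2,
    integral_integral_swap_of_hasCompactSupport (μ := μ) (ν := μ)
      (f := fun y z => starRingEnd ℂ (k z) * (h y * conjInv f (z * y⁻¹))),
    ← integral_conj]
  · congr 1 with y
    rw [← integral_conj]
    congr 1 with z
    simp only [conjInv_apply, map_mul, Complex.conj_conj, mul_inv_rev, inv_inv]
    ring
  · simp only [Function.uncurry_def]; fun_prop
  · exact hasCompactSupport_uncurry_of_mul k h _ fun y z => by rintro (h0 | h0) <;> simp [h0]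

/-- Urysohn bumps at the identity, divided by their integral. Nontriviality of the filter is what
makes limits along it unique. -/
instance approxUnit_neBot : (approxUnit μ).NeBot := by
  rw [approxUnit, lift'_neBot_iff (monotone_approxUnit_sets μ)]
  intro U hU
  obtain ⟨g, hg1, hgc, hgU, hg01⟩ := exists_continuousMap_one_of_isCompact_subset_isOpen
    (isCompact_singleton (x := (1 : G))) isOpen_interior
    (Set.singleton_subset_iff.2 (mem_interior_iff_mem_nhds.2 hU))
  have hpos : 0 < ∫ y, g y ∂μ := g.continuous.integral_pos_of_hasCompactSupport_nonneg_nonzero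
    (x := 1) hgc (fun x => (hg01 x).1) (by rw [hg1 (Set.mem_singleton _)]; exact one_ne_zero)
  set c := ∫ y, g y ∂μ
  have hφ : HasCompactSupport fun y => ((c⁻¹ * g y : ℝ) : ℂ) :=
    HasCompactSupport.comp_left (g := fun t : ℝ => ((c⁻¹ * t : ℝ) : ℂ)) hgc (by simp)
  refine ⟨⟨⟨fun y => ((c⁻¹ * g y : ℝ) : ℂ), by fun_prop⟩, hφ⟩, ?_, ?_, ?_⟩
  · change ∫ y, ((c⁻¹ * g y : ℝ) : ℂ) ∂μ = 1
    rw [integral_complex_ofReal, integral_const_mul, inv_mul_cancel₀ hpos.ne', Complex.ofReal_one]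
  · change ∫ y, ‖((c⁻¹ * g y : ℝ) : ℂ)‖ ∂μ ≤ 1
    have : ∀ y, ‖((c⁻¹ * g y : ℝ) : ℂ)‖ = c⁻¹ * g y := fun y => by
      rw [Complex.norm_real, Real.norm_of_nonneg (mul_nonneg (inv_nonneg.2 hpos.le) (hg01 y).1)]
    simp only [this]
    rw [integral_const_mul, inv_mul_cancel₀ hpos.ne']
  · intro y hy
    refine interior_subset (hgU (subset_tsupport _ fun h => hy ?_))
    change ((c⁻¹ * g y : ℝ) : ℂ) = 0
    simp [h]

/-- ξ * φ - ξ averages ρ_y ξ - ξ against φ, and this is small for y near 1 by strong continuity. -/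
theorem tendsto_rightConv_approxUnit [μ.IsMulRightInvariant] (ξ : Lp ℂ 2 μ) :
    Tendsto (fun φ => rightConv μ φ ξ) (approxUnit μ) (𝓝 ξ) := by
  refine Metric.tendsto_nhds.2 fun ε hε => ?_
  have hU : {y | ‖rightTranslation μ y ξ - ξ‖ ≤ ε / 2} ∈ 𝓝 (1 : G) := by
    have hc : Continuous fun y => ‖rightTranslation μ y ξ - ξ‖ :=
      ((continuous_rightTranslation μ ξ).sub continuous_const).norm
    have := hc.continuousAt (x := 1) |>.eventually_lt continuousAt_const
      (show ‖rightTranslation μ 1 ξ - ξ‖ < ε / 2 by simpa [rightTranslation_one] using hε)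
    exact this.mono fun y hy => le_of_lt hy
  refine mem_of_superset (mem_lift' hU) fun φ hφ => ?_
  obtain ⟨hφ1, hφ2, hφU⟩ := hφ
  have hint : Integrable φ μ := φ.continuous.integrable_of_hasCompactSupport φ.hasCompactSupport
  have h1 : rightConv μ φ ξ - ξ = ∫ y, φ y • (rightTranslation μ y ξ - ξ) ∂μ := by
    simp only [smul_sub]
    rw [integral_sub (integrable_smul_rightTranslation μ φ ξ) (hint.smul_const ξ),
      integral_smul_const, hφ1, one_smul, rightConv_apply]
  rw [Set.mem_ofPred_eq, dist_eq_norm, h1]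
  calc ‖∫ y, φ y • (rightTranslation μ y ξ - ξ) ∂μ‖ ≤ ∫ y, ‖φ y‖ * (ε / 2) ∂μ := by
        refine norm_integral_le_of_norm_le (hint.norm.mul_const _) (.of_forall fun y => ?_)
        rw [norm_smul]
        by_cases hy : φ y = 0
        · simp [hy]
        · exact mul_le_mul_of_nonneg_left (hφU hy) (norm_nonneg _)
    _ = (∫ y, ‖φ y‖ ∂μ) * (ε / 2) := integral_mul_const _ _
    _ ≤ 1 * (ε / 2) := by gcongr
    _ < ε := by linarith

end GroupCStar

end

/-! ### The commutant, its left-bounded ideal and the trace -/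

noncomputable section

namespace GroupCStar

variable {G : Type*} [Group G] [TopologicalSpace G] [IsTopologicalGroup G]
  [MeasurableSpace G] [BorelSpace G]

/-- The commutant of the right translations on `L²(G, μ)`. -/
def rightCommutant (μ : Measure G) [μ.IsMulRightInvariant] :
    StarSubalgebra ℂ (Lp ℂ 2 μ →L[ℂ] Lp ℂ 2 μ) :=
  StarSubalgebra.centralizer ℂ
    (Set.range fun y => (rightTranslation μ y).toContinuousLinearMap)

theorem star_rightTranslation (μ : Measure G) [μ.IsMulRightInvariant] (y : G) :
    star (rightTranslation μ y).toContinuousLinearMap =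
      (rightTranslation μ y⁻¹).toContinuousLinearMap := by
  rw [ContinuousLinearMap.star_eq_adjoint, eq_comm, ContinuousLinearMap.eq_adjoint_iff]
  intro ξ η
  change inner ℂ (rightTranslation μ y⁻¹ ξ) η = inner ℂ ξ (rightTranslation μ y η)
  rw [← (rightTranslation μ y).inner_map_map, rightTranslation_inv]

theorem mem_rightCommutant (μ : Measure G) [μ.IsMulRightInvariant]
    {T : Lp ℂ 2 μ →L[ℂ] Lp ℂ 2 μ} :
    T ∈ rightCommutant μ ↔ ∀ y ξ, T (rightTranslation μ y ξ) = rightTranslation μ y (T ξ) := by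
  rw [rightCommutant, StarSubalgebra.mem_centralizer_iff]
  refine ⟨fun h y ξ => ?_, fun h => ?_⟩
  · exact (congrArg (fun S : Lp ℂ 2 μ →L[ℂ] Lp ℂ 2 μ => S ξ) (h _ ⟨y, rfl⟩).1).symm
  · rintro _ ⟨y, rfl⟩
    rw [star_rightTranslation]
    exact ⟨ContinuousLinearMap.ext fun ξ => (h y ξ).symm,
      ContinuousLinearMap.ext fun ξ => (h y⁻¹ ξ).symm⟩

theorem isClosed_rightCommutant (μ : Measure G) [μ.IsMulRightInvariant] :
    IsClosed (rightCommutant μ : Set (Lp ℂ 2 μ →L[ℂ] Lp ℂ 2 μ)) :=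
  Set.isClosed_centralizer _

variable [LocallyCompactSpace G] (μ : Measure G) [μ.IsHaarMeasure] [μ.Regular]
  [μ.IsMulRightInvariant]

theorem convOperator_mem_rightCommutant (f : C_c(G, ℂ)) :
    convOperator μ f ∈ rightCommutant μ := by
  refine (mem_rightCommutant μ).2 fun y ξ => ?_
  have := (rightTranslation μ y).toContinuousLinearMap.integral_comp_comm
    (integrable_smul_leftRegular μ f ξ)
  rw [convOperator_apply, convOperator_apply]
  refine Eq.trans ?_ this
  congr 1 with x
  rw [leftRegular_rightTranslation, map_smul]
  rfl

theorem map_rightConv {T : Lp ℂ 2 μ →L[ℂ] Lp ℂ 2 μ} (hT : T ∈ rightCommutant μ) (h : C_c(G, ℂ))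
    (ξ : Lp ℂ 2 μ) : T (rightConv μ h ξ) = rightConv μ h (T ξ) := by
  rw [rightConv_apply, rightConv_apply,
    ← T.integral_comp_comm (integrable_smul_rightTranslation μ h ξ)]
  congr 1 with y
  rw [map_smul, (mem_rightCommutant μ).1 hT]

/-- The operators in the commutant of the right translations that act as left convolution by an
element of `L²(G, μ)`. -/
def leftBoundedIdeal : Submodule ℂ (Lp ℂ 2 μ →L[ℂ] Lp ℂ 2 μ) where
  carrier := {T | T ∈ rightCommutant μ ∧ ∃ ξ, ∀ h : C_c(G, ℂ), T (h.toL2 μ) = rightConv μ h ξ}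
  add_mem' := by
    rintro S T ⟨hS, ξ, hξ⟩ ⟨hT, η, hη⟩
    exact ⟨add_mem hS hT, ξ + η, fun h => by rw [map_add, ← hξ, ← hη]; rfl⟩
  zero_mem' := ⟨zero_mem _, 0, fun h => by rw [map_zero]; rfl⟩
  smul_mem' := by
    rintro c T ⟨hT, ξ, hξ⟩
    exact ⟨SMulMemClass.smul_mem c hT, c • ξ, fun h => by rw [map_smul, ← hξ]; rfl⟩

variable {μ}

theorem convOperator_mem_leftBoundedIdeal (f : C_c(G, ℂ)) :
    convOperator μ f ∈ leftBoundedIdeal μ :=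
  ⟨convOperator_mem_rightCommutant μ f, f.toL2 μ, convOperator_toL2 μ f⟩

theorem mul_mem_leftBoundedIdeal {S T : Lp ℂ 2 μ →L[ℂ] Lp ℂ 2 μ} (hS : S ∈ rightCommutant μ)
    (hT : T ∈ leftBoundedIdeal μ) : S * T ∈ leftBoundedIdeal μ := by
  obtain ⟨hT, ξ, hξ⟩ := hT
  refine ⟨mul_mem hS hT, S ξ, fun h => ?_⟩
  rw [mul_apply_eq_comp, hξ, map_rightConv μ hS]

theorem star_apply_toL2 [μ.IsInvInvariant] {T : Lp ℂ 2 μ →L[ℂ] Lp ℂ 2 μ} {ξ : Lp ℂ 2 μ}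
    (hξ : ∀ h : C_c(G, ℂ), T (h.toL2 μ) = rightConv μ h ξ) (h : C_c(G, ℂ)) :
    star T (h.toL2 μ) = rightConv μ h (modularConj μ ξ) := by
  refine (CompactlySupportedContinuousMap.denseRange_toL2 μ).eq_of_inner_right ℂ fun k => ?_
  rw [ContinuousLinearMap.star_eq_adjoint, ContinuousLinearMap.adjoint_inner_right, hξ,
    inner_rightConv_toL2]

theorem star_mem_leftBoundedIdeal {T : Lp ℂ 2 μ →L[ℂ] Lp ℂ 2 μ}
    (hT : T ∈ leftBoundedIdeal μ) : star T ∈ leftBoundedIdeal μ := by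
  have := Measure.IsHaarMeasure.isInvInvariant_of_isMulRightInvariant μ
  obtain ⟨hT, ξ, hξ⟩ := hT
  exact ⟨star_mem hT, modularConj μ ξ, star_apply_toL2 hξ⟩

/-- ⟨φ, STφ⟩ = ⟨S*φ, Tφ⟩ = ⟨Jξ * φ, η * φ⟩, and each factor converges. The vectors φ themselves need
not stay bounded in L². -/
theorem tendsto_inner_mul_approxUnit [μ.IsInvInvariant] {S T : Lp ℂ 2 μ →L[ℂ] Lp ℂ 2 μ}
    {ξ η : Lp ℂ 2 μ} (hξ : ∀ h : C_c(G, ℂ), S (h.toL2 μ) = rightConv μ h ξ)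
    (hη : ∀ h : C_c(G, ℂ), T (h.toL2 μ) = rightConv μ h η) :
    Tendsto (fun φ : C_c(G, ℂ) => inner ℂ (φ.toL2 μ) ((S * T) (φ.toL2 μ))) (approxUnit μ)
      (𝓝 (inner ℂ (modularConj μ ξ) η)) := by
  refine ((tendsto_rightConv_approxUnit μ (modularConj μ ξ)).inner
    (tendsto_rightConv_approxUnit μ η)).congr fun φ => ?_
  rw [mul_apply_eq_comp, ← star_apply_toL2 hξ, ← hη, ContinuousLinearMap.star_eq_adjoint,
    ContinuousLinearMap.adjoint_inner_left]

/-- The trace property reduces to ⟨Jξ, η⟩ = ⟨Jη, ξ⟩, as J reverses inner products and J² = 1. -/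
theorem tendsto_inner_commutator_approxUnit {S T : Lp ℂ 2 μ →L[ℂ] Lp ℂ 2 μ}
    (hS : S ∈ leftBoundedIdeal μ) (hT : T ∈ leftBoundedIdeal μ) :
    Tendsto (fun φ : C_c(G, ℂ) => inner ℂ (φ.toL2 μ) ((S * T - T * S) (φ.toL2 μ)))
      (approxUnit μ) (𝓝 0) := by
  have := Measure.IsHaarMeasure.isInvInvariant_of_isMulRightInvariant μ
  obtain ⟨-, ξ, hξ⟩ := hS
  obtain ⟨-, η, hη⟩ := hT
  have h1 := (tendsto_inner_mul_approxUnit hξ hη).sub (tendsto_inner_mul_approxUnit hη hξ)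
  have h2 : inner ℂ (modularConj μ ξ) η = inner ℂ (modularConj μ η) ξ := by
    rw [← inner_modularConj, modularConj_modularConj]
  rw [h2, sub_self] at h1
  refine h1.congr fun φ => ?_
  rw [← inner_sub_right]
  rfl

/-- Faithfulness: Tφ = ξ * φ → ξ recovers the symbol, and the symbol determines T on a dense
subspace. -/
theorem eq_zero_of_tendsto_approxUnit {T : Lp ℂ 2 μ →L[ℂ] Lp ℂ 2 μ}
    (hT : T ∈ leftBoundedIdeal μ)
    (h : Tendsto (fun φ : C_c(G, ℂ) => T (φ.toL2 μ)) (approxUnit μ) (𝓝 0)) : T = 0 := by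
  obtain ⟨-, ξ, hξ⟩ := hT
  simp only [hξ] at h
  have hξ0 : ξ = 0 := tendsto_nhds_unique (tendsto_rightConv_approxUnit μ ξ) h
  refine ContinuousLinearMap.ext fun η => ?_
  refine (CompactlySupportedContinuousMap.denseRange_toL2 μ).induction_on η
    (isClosed_eq T.continuous continuous_const) fun f => ?_
  rw [hξ, hξ0, map_zero]
  rfl

variable (μ)

theorem reducedCStar_subset_closure :
    (reducedCStar μ : Set (Lp ℂ 2 μ →L[ℂ] Lp ℂ 2 μ)) ⊆
      closure (leftBoundedIdeal μ : Set (Lp ℂ 2 μ →L[ℂ] Lp ℂ 2 μ)) := by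
  let I : NonUnitalStarSubalgebra ℂ (Lp ℂ 2 μ →L[ℂ] Lp ℂ 2 μ) :=
    { leftBoundedIdeal μ with
      mul_mem' := fun hS hT => mul_mem_leftBoundedIdeal hS.1 hT
      star_mem' := star_mem_leftBoundedIdeal }
  have h : NonUnitalStarAlgebra.adjoin ℂ (Set.range (convOperator μ)) ≤ I := by
    refine NonUnitalStarAlgebra.adjoin_le ?_
    rintro _ ⟨f, rfl⟩
    exact convOperator_mem_leftBoundedIdeal f
  exact closure_mono h

theorem reducedCStar_subset_rightCommutant {a : Lp ℂ 2 μ →L[ℂ] Lp ℂ 2 μ}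
    (ha : a ∈ reducedCStar μ) : a ∈ rightCommutant μ :=
  closure_minimal (fun _ hT => hT.1) (isClosed_rightCommutant μ)
    (reducedCStar_subset_closure μ ha)

/-- In the reduced group C⋆-algebra of a unimodular group, left quasi-inverses are right
quasi-inverses. -/
theorem isQuasiInversePair_symm {a b : reducedCStar μ} (h : IsQuasiInversePair b a) :
    IsQuasiInversePair a b := by
  have hba : (b : Lp ℂ 2 μ →L[ℂ] Lp ℂ 2 μ) + a - b * a = 0 := congrArg Subtype.val h
  have hab := mul_eq_one_of_asymptotic_trace
    (Set.range fun y => (rightTranslation μ y).toContinuousLinearMap) (leftBoundedIdeal μ)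
    (map (CompactlySupportedContinuousMap.toL2 μ) (approxUnit μ)) (fun T hT => hT.1)
    (fun T hT => star_mem_leftBoundedIdeal hT) (fun S hS T hT => mul_mem_leftBoundedIdeal hS hT)
    (fun S hS T hT => tendsto_map'_iff.2 (tendsto_inner_commutator_approxUnit hS hT))
    (fun T hT hl => eq_zero_of_tendsto_approxUnit hT (tendsto_map'_iff.1 hl))
    (a := a) (u := 1 - b) (reducedCStar_subset_closure μ a.2)
    (sub_mem (one_mem (rightCommutant μ)) (reducedCStar_subset_rightCommutant μ b.2))
    (by
      have : (1 - b : Lp ℂ 2 μ →L[ℂ] Lp ℂ 2 μ) * (1 - a) = 1 - (b + a - b * a) := by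
        noncomm_ring
      rw [this, hba, sub_zero])
  refine Subtype.ext ?_
  change (a : Lp ℂ 2 μ →L[ℂ] Lp ℂ 2 μ) + b - a * b = 0
  have : (a : Lp ℂ 2 μ →L[ℂ] Lp ℂ 2 μ) + b - a * b = 1 - (1 - a) * (1 - b) := by noncomm_ring
  rw [this, hab, sub_self]

end GroupCStar

end

/-! ### Passage to the unitization and conclusion -/

/-- If left quasi-inverses are right quasi-inverses in `R`, then the unitization of `R` is directly
finite. -/
theorem Unitization.isDedekindFiniteMonoid_of_isQuasiInversePair {𝕜 R : Type*} [Field 𝕜]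
    [NonUnitalRing R] [Module 𝕜 R] [IsScalarTower 𝕜 R R] [SMulCommClass 𝕜 R R]
    (h : ∀ a b : R, IsQuasiInversePair b a → IsQuasiInversePair a b) :
    IsDedekindFiniteMonoid (Unitization 𝕜 R) := by
  refine ⟨fun {u v} huv => ?_⟩
  have hfst : u.fst * v.fst = 1 := by simpa using congrArg (fun w => w.fst) huv
  have hsnd : u.fst • v.snd + v.fst • u.snd + u.snd * v.snd = 0 := by
    simpa using congrArg (fun w => w.snd) huv
  have hprod : ∀ x y : R, (v.fst • x) * (u.fst • y) = x * y := fun x y => by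
    rw [smul_mul_smul_comm, mul_comm, hfst, one_smul]
  have hprod' : ∀ x y : R, (u.fst • x) * (v.fst • y) = x * y := fun x y => by
    rw [smul_mul_smul_comm, hfst, one_smul]
  -- For u = (s, x) and v = (t, y) with st = 1, write u = s(1 + tx) and v = t(1 + sy); then uv = 1
  -- reads (1 + tx)(1 + sy) = 1.
  have key := h (-(u.fst • v.snd)) (-(v.fst • u.snd)) (by
    rw [IsQuasiInversePair, neg_mul_neg, hprod, ← neg_eq_zero, ← hsnd]
    abel)
  rw [IsQuasiInversePair, neg_mul_neg, hprod'] at key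
  refine Unitization.ext (by simpa [mul_comm] using hfst) ?_
  rw [Unitization.snd_mul, Unitization.snd_one, ← neg_eq_zero, ← key]
  abel

theorem theorem3 {G : Type*} [Group G] [TopologicalSpace G] [IsTopologicalGroup G]
    [LocallyCompactSpace G] [MeasurableSpace G] [BorelSpace G]
    (μ : Measure G) [μ.IsHaarMeasure] [μ.Regular]
    (unimodular : μ.IsMulRightInvariant) :
    IsQuasiDirectlyFinite (GroupCStar.reducedCStar μ) ∧
      IsDedekindFiniteMonoid (Unitization ℂ (GroupCStar.reducedCStar μ)) :=
  ⟨fun _ ⟨b, hb⟩ => ⟨b, GroupCStar.isQuasiInversePair_symm μ hb⟩,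
    Unitization.isDedekindFiniteMonoid_of_isQuasiInversePair
      fun _ _ => GroupCStar.isQuasiInversePair_symm μ⟩
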